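/- A cone in $\mathbb R^n$ is a non-empty open set $V\subset\mathbb R^n$ such that $\lambda x\in V$ and $x+y\in V$ for all $x,y\in V$, $\lambda>0$, and such that $x\in\overline V$, $x\neq 0$ imply $-x\notin\overline V$. Its dual is $V^*=\{x\in\mathbb R^n : x\cdot y>0 \text{ for all } y\in\overline V,\ y\ne 0\}$, and $G(V)$ is the group of all real $n\times n$ matrices $A$ with $A V=V$. The cone $V$ is homogeneous if for all $x,y\in V$ there is $A\in G(V)$ with $y=Ax$. For a cone $W$ and $x\in W$, let $\Delta_W(x)$ be the Lebesgue measure of the cone interval $\langle 0,x\rangle=\{y\in W : x-y\in W\}$. **Theorem 3.12.** Let $V\subset\mathbb R^n$ be a homogeneous cone and let $\beta,\delta\in\mathbb R$. Let $k:V^*\times V\to[0,\infty)$ be a kernel such that $k(x,\cdot)$ is Lebesgue measurable on $V$ for every $x\in V^*$ and which is $V^*\times V$-homogeneous of order $\beta$, that is, $$k\big((A^t)^{-1}x,\,Ay\big)=|\det A|^{\beta}\,k(x,y)\qquad\text{for all } A\in G(V),\ x\in V^*,\ y\in V.$$ Assume that $$\int_V k(x,y)\,\Delta_V^{\delta}(y)\,dy<\infty\qquad\text{for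 every } x\in V^*.$$ Then there is a finite constant $c\ge 0$, independent of $f$, such that for every Lebesgue measurable $f:V\to[0,\infty)$, with $Kf(x)=\int_V k(x,y)f(y)\,dy\in[0,\infty]$, $$\operatorname*{ess\,sup}_{x\in V^*}\ \Delta_{V^*}^{1+\delta+\beta}(x)\,Kf(x)\ \le\ c\,\operatorname*{ess\,sup}_{y\in V}\ f(y)\,\Delta_V^{-\delta}(y),$$ both sides being taken in $[0,\infty]$ (with $0\cdot\infty=0$). -/

import Mathlib

open MeasureTheory
open scoped NNReal ENNReal Matrix

/-- The linear action `x ↦ A x` of a real `n × n` matrix on Euclidean space. -/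
noncomputable def matAct {n : ℕ} (A : Matrix (Fin n) (Fin n) ℝ) (x : EuclideanSpace ℝ (Fin n)) :
    EuclideanSpace ℝ (Fin n) :=
  WithLp.toLp 2 (A *ᵥ WithLp.ofLp x)

/-- A cone in `ℝⁿ`: a non-empty open set, stable under positive dilations and sums, whose closure
contains no pair `x, -x` with `x ≠ 0`. -/
structure IsOpenCone {n : ℕ} (V : Set (EuclideanSpace ℝ (Fin n))) : Prop where
  nonempty : V.Nonempty
  isOpen : IsOpen V
  smul_mem : ∀ x ∈ V, ∀ r : ℝ, 0 < r → r • x ∈ V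
  add_mem : ∀ x ∈ V, ∀ y ∈ V, x + y ∈ V
  neg_notMem_closure : ∀ x ∈ closure V, x ≠ 0 → -x ∉ closure V

/-- The (open) dual `V*` of `V`. -/
def dualOpenCone {n : ℕ} (V : Set (EuclideanSpace ℝ (Fin n))) :
    Set (EuclideanSpace ℝ (Fin n)) :=
  {x | ∀ y ∈ closure V, y ≠ 0 → 0 < inner ℝ x y}

/-- `G(V)`: the matrices that map `V` onto `V`. For a cone `V` they are automatically invertible,
because `V` is open and non-empty. -/
def coneAut {n : ℕ} (V : Set (EuclideanSpace ℝ (Fin n))) : Set (Matrix (Fin n) (Fin n) ℝ) :=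
  {A | matAct A '' V = V}

/-- A homogeneous cone: a cone on which `G(V)` acts transitively. -/
structure IsHomogeneousCone {n : ℕ} (V : Set (EuclideanSpace ℝ (Fin n))) : Prop
    extends IsOpenCone V where
  transitive : ∀ x ∈ V, ∀ y ∈ V, ∃ A ∈ coneAut V, y = matAct A x

/-- The cone interval `⟨a, b⟩ = {y ∈ V : y - a ∈ V, b - y ∈ V}`. -/
def coneInterval {n : ℕ} (V : Set (EuclideanSpace ℝ (Fin n))) (a b : EuclideanSpace ℝ (Fin n)) :
    Set (EuclideanSpace ℝ (Fin n)) :=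
  {y | y ∈ V ∧ y - a ∈ V ∧ b - y ∈ V}

/-- `Δ_V(x)`: the Lebesgue measure of the cone interval `⟨0, x⟩`. -/
noncomputable def coneDelta {n : ℕ} (V : Set (EuclideanSpace ℝ (Fin n)))
    (x : EuclideanSpace ℝ (Fin n)) : ℝ≥0∞ :=
  volume (coneInterval V 0 x)

/-- The kernel `k`, of which only the values on `V* × V` matter, is `V* × V`-homogeneous of
order `β`: `k((Aᵀ)⁻¹ x, A y) = |det A| ^ β * k(x, y)` for all `A ∈ G(V)`. -/
def IsDualHomogeneousKernel {n : ℕ} (V : Set (EuclideanSpace ℝ (Fin n))) (β : ℝ)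
    (k : EuclideanSpace ℝ (Fin n) → EuclideanSpace ℝ (Fin n) → ℝ≥0) : Prop :=
  ∀ A ∈ coneAut V, ∀ x ∈ dualOpenCone V, ∀ y ∈ V,
    (k (matAct (Aᵀ)⁻¹ x) (matAct A y) : ℝ) = |A.det| ^ β * (k x y : ℝ)

/-- The integral operator `K f(x) = ∫_V k(x, y) f(y) dy`, with values in `[0, ∞]`. -/
noncomputable def coneOperator {n : ℕ} (V : Set (EuclideanSpace ℝ (Fin n)))
    (k : EuclideanSpace ℝ (Fin n) → EuclideanSpace ℝ (Fin n) → ℝ≥0)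
    (f : EuclideanSpace ℝ (Fin n) → ℝ≥0) (x : EuclideanSpace ℝ (Fin n)) : ℝ≥0∞ :=
  ∫⁻ y in V, (k x y : ℝ≥0∞) * (f y : ℝ≥0∞)

/-! ### Linear action, determinants and change of variables. -/

section MatrixAction

variable {n : ℕ}

/-! If `M` denotes the right-hand essential supremum, then `f ≤ M Δ_V^δ` almost everywhere, so
`Kf(x) ≤ M ∫_V k(x,y) Δ_V^δ(y) dy`. Multiplied by `Δ_{V*}^{1+δ+β}(x)`, this integral is invariant
under `x ↦ (Aᵀ)⁻¹x` for `A ∈ G(V)`: the Jacobian, the kernel and the two interval volumes contribute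
powers of `|det A|` that cancel (`coneDelta_rpow_mul_lintegral_eq`). It is therefore a constant,
finite by hypothesis, once `G(V)` acts transitively on `V*`.

That transitivity (`transitive_dual`) is the real content. With `φ(x) = ∫_{V*} exp(-x·y) dy`, each
`ξ ∈ V*` is attached to a minimiser of `exp(x·ξ) φ(x)` on `V`. A minimiser exists because the
function is coercive and `φ = ∞` on the boundary (`koszulChar_eq_top`); it determines `ξ`, which
must be `-∇ log φ` there. The construction is equivariant, so transitivity passes from `V` to `V*`.
Uniqueness of the minimiser is not needed. -/

theorem matAct_eq_toLpLin (A : Matrix (Fin n) (Fin n) ℝ) :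
    matAct A = ⇑(Matrix.toLpLin 2 2 A) := rfl

theorem matAct_mul (A B : Matrix (Fin n) (Fin n) ℝ) (x : EuclideanSpace ℝ (Fin n)) :
    matAct (A * B) x = matAct A (matAct B x) := by
  simp [matAct]

theorem matAct_one (x : EuclideanSpace ℝ (Fin n)) : matAct 1 x = x := by
  simp [matAct]

theorem matAct_sub (A : Matrix (Fin n) (Fin n) ℝ) (x y : EuclideanSpace ℝ (Fin n)) :
    matAct A (x - y) = matAct A x - matAct A y := by
  simp [matAct_eq_toLpLin]

theorem matAct_zero (A : Matrix (Fin n) (Fin n) ℝ) :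
    matAct A (0 : EuclideanSpace ℝ (Fin n)) = 0 := by
  simp [matAct_eq_toLpLin]

theorem continuous_matAct (A : Matrix (Fin n) (Fin n) ℝ) :
    Continuous (matAct A : EuclideanSpace ℝ (Fin n) → _) := by
  rw [matAct_eq_toLpLin]
  exact LinearMap.continuous_of_finiteDimensional _

theorem inner_matAct_transpose (A : Matrix (Fin n) (Fin n) ℝ) (x y : EuclideanSpace ℝ (Fin n)) :
    inner ℝ (matAct Aᵀ x) y = inner ℝ x (matAct A y) := by
  simp only [matAct, EuclideanSpace.inner_eq_star_dotProduct, star_trivial]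
  rw [Matrix.mulVec_transpose, dotProduct_comm, ← Matrix.dotProduct_mulVec, dotProduct_comm]

theorem matAct_inv_matAct {A : Matrix (Fin n) (Fin n) ℝ} (hA : A.det ≠ 0)
    (x : EuclideanSpace ℝ (Fin n)) : matAct A⁻¹ (matAct A x) = x := by
  rw [← matAct_mul, Matrix.nonsing_inv_mul _ hA.isUnit, matAct_one]

theorem matAct_matAct_inv {A : Matrix (Fin n) (Fin n) ℝ} (hA : A.det ≠ 0)
    (x : EuclideanSpace ℝ (Fin n)) : matAct A (matAct A⁻¹ x) = x := by
  rw [← matAct_mul, Matrix.mul_nonsing_inv _ hA.isUnit, matAct_one]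

theorem matAct_injective {A : Matrix (Fin n) (Fin n) ℝ} (hA : A.det ≠ 0) :
    Function.Injective (matAct A : EuclideanSpace ℝ (Fin n) → _) :=
  Function.LeftInverse.injective (matAct_inv_matAct hA)

theorem inner_matAct_transpose_inv {A : Matrix (Fin n) (Fin n) ℝ} (hA : A.det ≠ 0)
    (x y : EuclideanSpace ℝ (Fin n)) :
    inner ℝ (matAct (Aᵀ)⁻¹ x) (matAct A y) = inner ℝ x y := by
  rw [← Matrix.transpose_nonsing_inv, inner_matAct_transpose, matAct_inv_matAct hA]

theorem det_transpose_inv_ne_zero {A : Matrix (Fin n) (Fin n) ℝ} (hA : A.det ≠ 0) :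
    ((Aᵀ)⁻¹).det ≠ 0 := by
  rw [Matrix.det_nonsing_inv, Matrix.det_transpose, Ring.inverse_eq_inv']
  exact inv_ne_zero hA

/-- The range is a subspace containing a non-empty open set, hence everything. -/
theorem det_ne_zero_of_image_matAct {A : Matrix (Fin n) (Fin n) ℝ}
    {W : Set (EuclideanSpace ℝ (Fin n))} (hW : IsOpen W) (hne : W.Nonempty)
    (h : matAct A '' W = W) : A.det ≠ 0 := by
  have htop : LinearMap.range (Matrix.toLpLin 2 2 A :
      EuclideanSpace ℝ (Fin n) →ₗ[ℝ] EuclideanSpace ℝ (Fin n)) = ⊤ := by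
    apply Submodule.eq_top_of_nonempty_interior'
    refine hne.mono (interior_maximal ?_ hW)
    rw [← h]
    rintro _ ⟨x, -, rfl⟩
    exact ⟨x, rfl⟩
  have hu := (LinearMap.isUnit_iff_range_eq_top _).2 htop
  have := LinearMap.isUnit_det _ hu
  rw [LinearMap.det_toLpLin] at this
  exact this.ne_zero

/-- Change of variables for a linear map preserving a measurable set. -/
theorem setLIntegral_comp_matAct {A : Matrix (Fin n) (Fin n) ℝ} (hA : A.det ≠ 0)
    {W : Set (EuclideanSpace ℝ (Fin n))} (hW : MeasurableSet W) (h : matAct A '' W = W)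
    (f : EuclideanSpace ℝ (Fin n) → ℝ≥0∞) :
    ∫⁻ y in W, f y = ENNReal.ofReal |A.det| * ∫⁻ y in W, f (matAct A y) := by
  have key := lintegral_image_eq_lintegral_abs_det_fderiv_mul (volume) hW
    (f := matAct A) (f' := fun _ => LinearMap.toContinuousLinearMap (Matrix.toLpLin 2 2 A))
    (fun x _ => ((LinearMap.toContinuousLinearMap (Matrix.toLpLin 2 2 A)).hasFDerivAt
      (x := x)).hasFDerivWithinAt) (matAct_injective hA).injOn f
  rw [h] at key
  rw [key, ← lintegral_const_mul' _ _ ENNReal.ofReal_ne_top]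
  simp [LinearMap.det_toContinuousLinearMap, LinearMap.det_toLpLin]

theorem coneDelta_matAct {A : Matrix (Fin n) (Fin n) ℝ} (hA : A.det ≠ 0)
    {W : Set (EuclideanSpace ℝ (Fin n))} (h : matAct A '' W = W) (x : EuclideanSpace ℝ (Fin n)) :
    coneDelta W (matAct A x) = ENNReal.ofReal |A.det| * coneDelta W x := by
  have hmem : ∀ y, matAct A y ∈ W ↔ y ∈ W := fun y => by
    conv_lhs => rw [← h]
    exact (matAct_injective hA).mem_set_image
  have himg : coneInterval W 0 (matAct A x) = matAct A '' coneInterval W 0 x := by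
    ext y
    constructor
    · intro hy
      refine ⟨matAct A⁻¹ y, ?_, matAct_matAct_inv hA y⟩
      simp only [coneInterval, Set.mem_ofPred_eq, sub_zero] at hy ⊢
      rw [← hmem (matAct A⁻¹ y), ← hmem (x - matAct A⁻¹ y), matAct_sub, matAct_matAct_inv hA]
      exact hy
    · rintro ⟨y, hy, rfl⟩
      simp only [coneInterval, Set.mem_ofPred_eq, sub_zero] at hy ⊢
      rwa [← matAct_sub, hmem, hmem]
  rw [coneDelta, himg, matAct_eq_toLpLin, Measure.addHaar_image_linearMap,
    LinearMap.det_toLpLin, coneDelta]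

end MatrixAction

/-! ### Coercivity, the dual cone and interval volumes. -/

section Cones

variable {n : ℕ} {V : Set (EuclideanSpace ℝ (Fin n))}

theorem IsOpenCone.inv_mem_coneAut (hV : IsOpenCone V) {A : Matrix (Fin n) (Fin n) ℝ}
    (hA : A ∈ coneAut V) : A⁻¹ ∈ coneAut V := by
  have hdet := det_ne_zero_of_image_matAct hV.isOpen hV.nonempty hA
  change matAct A⁻¹ '' V = V
  conv_lhs => rw [← show matAct A '' V = V from hA]
  rw [Set.image_image]
  simp [matAct_inv_matAct hdet]

theorem matAct_mem_closure {A : Matrix (Fin n) (Fin n) ℝ}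
    (hA : A ∈ coneAut V) {x : EuclideanSpace ℝ (Fin n)} (hx : x ∈ closure V) :
    matAct A x ∈ closure V := by
  have : Set.MapsTo (matAct A) V V := fun y hy => by
    rw [← show matAct A '' V = V from hA]; exact ⟨y, hy, rfl⟩
  exact this.closure (continuous_matAct A) hx

theorem IsOpenCone.image_dualOpenCone (hV : IsOpenCone V) {A : Matrix (Fin n) (Fin n) ℝ}
    (hA : A ∈ coneAut V) : matAct (Aᵀ)⁻¹ '' dualOpenCone V = dualOpenCone V := by
  have hdet := det_ne_zero_of_image_matAct hV.isOpen hV.nonempty hA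
  have hinv := hV.inv_mem_coneAut hA
  have hdet' := det_ne_zero_of_image_matAct hV.isOpen hV.nonempty hinv
  have key : ∀ {B : Matrix (Fin n) (Fin n) ℝ}, B ∈ coneAut V → B.det ≠ 0 →
      ∀ x ∈ dualOpenCone V, matAct Bᵀ x ∈ dualOpenCone V := by
    intro B hB hBd x hx y hy hy0
    rw [inner_matAct_transpose]
    refine hx _ (matAct_mem_closure hB hy) fun h0 => hy0 ?_
    exact matAct_injective hBd (h0.trans (matAct_zero B).symm)
  apply Set.Subset.antisymm
  · rintro _ ⟨x, hx, rfl⟩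
    rw [← Matrix.transpose_nonsing_inv]
    exact key hinv hdet' x hx
  · intro x hx
    refine ⟨matAct Aᵀ x, key hA hdet x hx, ?_⟩
    exact matAct_inv_matAct (by rwa [Matrix.det_transpose]) x

theorem IsOpenCone.convex (hV : IsOpenCone V) : Convex ℝ V := by
  intro x hx y hy a b ha hb hab
  rcases ha.eq_or_lt with rfl | ha
  · simpa [show b = 1 by linarith] using hy
  rcases hb.eq_or_lt with rfl | hb
  · simpa [show a = 1 by linarith] using hx
  exact hV.add_mem _ (hV.smul_mem x hx a ha) _ (hV.smul_mem y hy b hb)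

theorem IsOpenCone.smul_mem_closure (hV : IsOpenCone V) {x : EuclideanSpace ℝ (Fin n)}
    (hx : x ∈ closure V) {r : ℝ} (hr : 0 < r) : r • x ∈ closure V :=
  (show Set.MapsTo (fun y => r • y) V V from fun y hy => hV.smul_mem y hy r hr).closure
    (continuous_const_smul r) hx

theorem inner_nonneg_of_mem_dualOpenCone {x y : EuclideanSpace ℝ (Fin n)}
    (hx : x ∈ dualOpenCone V) (hy : y ∈ closure V) : 0 ≤ inner ℝ x y := by
  rcases eq_or_ne y 0 with rfl | h
  · simp
  · exact (hx y hy h).le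

/-- Compactness of the unit-sphere section of `closure V` gives a positive minimum; homogeneity does
the rest. -/
theorem IsOpenCone.exists_mul_norm_le_inner_closure (hV : IsOpenCone V)
    {ξ : EuclideanSpace ℝ (Fin n)} (hξ : ξ ∈ dualOpenCone V) :
    ∃ c : ℝ, 0 < c ∧ ∀ z ∈ closure V, c * ‖z‖ ≤ inner ℝ ξ z := by
  have hK : IsCompact (closure V ∩ Metric.sphere 0 1) :=
    (isCompact_sphere _ _).inter_left isClosed_closure
  obtain ⟨c, hc, hle⟩ : ∃ c : ℝ, 0 < c ∧ ∀ z ∈ closure V ∩ Metric.sphere 0 1,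
      c ≤ inner ℝ ξ z := by
    rcases (closure V ∩ Metric.sphere 0 1).eq_empty_or_nonempty with h | h
    · exact ⟨1, one_pos, by simp [h]⟩
    · obtain ⟨z, hz, hmin⟩ := hK.exists_isMinOn h
        (f := fun z => (inner ℝ ξ z : ℝ)) (by fun_prop)
      refine ⟨inner ℝ ξ z, hξ z hz.1 ?_, fun w hw => hmin hw⟩
      rintro rfl
      simpa using hz.2
  refine ⟨c, hc, fun z hz => ?_⟩
  rcases eq_or_ne z 0 with rfl | h0
  · simp
  have hpos : 0 < ‖z‖ := norm_pos_iff.2 h0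
  have := hle (‖z‖⁻¹ • z) ⟨hV.smul_mem_closure hz (inv_pos.2 hpos), by
    simp [norm_smul, hpos.ne']⟩
  rw [inner_smul_right, inv_mul_eq_div, le_div_iff₀ hpos] at this
  exact this

/-- Since `x` is interior, `x - (ε/2) z/‖z‖` stays in `V`; pairing it with `z` gives the bound. -/
theorem IsOpenCone.exists_mul_norm_le_inner_dual (hV : IsOpenCone V)
    {x : EuclideanSpace ℝ (Fin n)} (hx : x ∈ V) :
    ∃ c : ℝ, 0 < c ∧ ∀ z ∈ dualOpenCone V, c * ‖z‖ ≤ inner ℝ x z := by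
  obtain ⟨ε, hε, hball⟩ := Metric.isOpen_iff.1 hV.isOpen x hx
  refine ⟨ε / 2, by positivity, fun z hz => ?_⟩
  rcases eq_or_ne z 0 with rfl | h0
  · simp
  have hpos : 0 < ‖z‖ := norm_pos_iff.2 h0
  have hmem : x - (ε / 2 * ‖z‖⁻¹) • z ∈ V := hball (by
    rw [Metric.mem_ball, dist_eq_norm, sub_sub_cancel_left, norm_neg, norm_smul,
      Real.norm_of_nonneg (by positivity), mul_assoc, inv_mul_cancel₀ hpos.ne']
    linarith)
  have := inner_nonneg_of_mem_dualOpenCone hz (subset_closure hmem)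
  rw [inner_sub_right, inner_smul_right, real_inner_self_eq_norm_sq, real_inner_comm] at this
  have h2 : ε / 2 * ‖z‖⁻¹ * ‖z‖ ^ 2 = ε / 2 * ‖z‖ := by field_simp
  linarith

theorem IsOpenCone.isOpen_dualOpenCone (hV : IsOpenCone V) : IsOpen (dualOpenCone V) := by
  rw [Metric.isOpen_iff]
  intro ξ hξ
  obtain ⟨c, hc, h⟩ := hV.exists_mul_norm_le_inner_closure hξ
  refine ⟨c, hc, fun η hη y hy hy0 => ?_⟩
  rw [Metric.mem_ball, dist_eq_norm] at hη
  have h1 := h y hy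
  have h2 := abs_le.1 (abs_real_inner_le_norm (η - ξ) y)
  rw [inner_sub_left] at h2
  have h3 := mul_lt_mul_of_pos_right hη (norm_pos_iff.2 hy0)
  linarith [h2.1]

theorem smul_mem_dualOpenCone {x : EuclideanSpace ℝ (Fin n)} (hx : x ∈ dualOpenCone V)
    {r : ℝ} (hr : 0 < r) : r • x ∈ dualOpenCone V := fun y hy hy0 => by
  rw [inner_smul_left]
  exact mul_pos hr (hx y hy hy0)

/-- The interval function of an open set stable under positive dilations is positive. -/
theorem coneDelta_ne_zero {W : Set (EuclideanSpace ℝ (Fin n))} (hW : IsOpen W)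
    (hsmul : ∀ x ∈ W, ∀ r : ℝ, 0 < r → r • x ∈ W) {x : EuclideanSpace ℝ (Fin n)} (hx : x ∈ W) :
    coneDelta W x ≠ 0 := by
  have hopen : IsOpen (coneInterval W 0 x) := by
    simp only [coneInterval, sub_zero]
    exact hW.inter (hW.inter (hW.preimage (by fun_prop)))
  refine (hopen.measure_pos volume ⟨(1 / 2 : ℝ) • x, ?_⟩).ne'
  have h := hsmul x hx (1 / 2) (by norm_num)
  refine ⟨h, by simpa using h, ?_⟩
  convert h using 1
  module

/-- The interval function is finite when some linear functional is coercive on the cone. -/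
theorem coneDelta_ne_top {W : Set (EuclideanSpace ℝ (Fin n))} {ξ : EuclideanSpace ℝ (Fin n)}
    {c : ℝ} (hc : 0 < c) (h : ∀ z ∈ W, c * ‖z‖ ≤ inner ℝ ξ z) (x : EuclideanSpace ℝ (Fin n)) :
    coneDelta W x ≠ ∞ := by
  have hsub : coneInterval W 0 x ⊆ Metric.closedBall 0 (inner ℝ ξ x / c) := by
    rintro y ⟨hy, -, hxy⟩
    rw [mem_closedBall_zero_iff, le_div_iff₀ hc]
    have h1 := h y hy
    have h2 := h _ hxy
    rw [inner_sub_right] at h2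
    have := mul_nonneg hc.le (norm_nonneg (x - y))
    linarith
  exact ((measure_mono hsub).trans_lt measure_closedBall_lt_top).ne

end Cones

/-! ### The characteristic function and transitivity on the dual cone. -/

section Laplace

variable {n : ℕ} {V : Set (EuclideanSpace ℝ (Fin n))}

/-- The Koszul–Vinberg characteristic function `x ↦ ∫_W exp (-x · y) dy` of a set `W`. -/
noncomputable def koszulChar (W : Set (EuclideanSpace ℝ (Fin n)))
    (x : EuclideanSpace ℝ (Fin n)) : ℝ≥0∞ :=
  ∫⁻ y in W, ENNReal.ofReal (Real.exp (-inner ℝ x y))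

/-- An integral depending on a parameter is lower semicontinuous if its integrand is continuous
in the parameter. -/
theorem lowerSemicontinuous_lintegral_of_continuous {α E : Type*} [MeasurableSpace α]
    {μ : Measure α} [TopologicalSpace E] [FirstCountableTopology E] {f : E → α → ℝ≥0∞}
    (hm : ∀ x, Measurable (f x)) (hc : ∀ y, Continuous fun x => f x y) :
    LowerSemicontinuous fun x => ∫⁻ y, f x y ∂μ := by
  rw [lowerSemicontinuous_iff_le_liminf]
  intro x
  -- Fatou along the neighbourhood filter, which first countability makes countably generated.
  refine le_trans (le_of_eq ?_) (lintegral_liminf_le hm)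
  exact lintegral_congr fun y => ((hc y).tendsto x).liminf_eq.symm

theorem koszulChar_matAct {W : Set (EuclideanSpace ℝ (Fin n))} (hW : MeasurableSet W)
    {A : Matrix (Fin n) (Fin n) ℝ} (hA : A.det ≠ 0) (h : matAct (Aᵀ)⁻¹ '' W = W)
    (x : EuclideanSpace ℝ (Fin n)) :
    koszulChar W (matAct A x) = ENNReal.ofReal |((Aᵀ)⁻¹).det| * koszulChar W x := by
  rw [koszulChar, setLIntegral_comp_matAct (det_transpose_inv_ne_zero hA) hW h, koszulChar]
  congr 1
  refine lintegral_congr fun y => ?_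
  rw [real_inner_comm, inner_matAct_transpose_inv hA, real_inner_comm]

theorem integrable_exp_neg_mul_norm {c : ℝ} (hc : 0 < c) :
    Integrable (fun y : EuclideanSpace ℝ (Fin n) => Real.exp (-(c * ‖y‖))) := by
  have h1 : Integrable (fun y : EuclideanSpace ℝ (Fin n) =>
      (1 + ‖y‖) ^ (-((n + 1 : ℕ) : ℝ))) := integrable_one_add_norm (by simp)
  -- The constant comes from `t ^ (n+1) / (n+1)! ≤ exp t` at `t = c (1 + ‖y‖)`; the exponent `n + 1`
  -- exceeds the dimension, so the majorant is integrable.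
  refine (h1.const_mul (Real.exp c * (n + 1).factorial / c ^ (n + 1))).mono'
    (by fun_prop) (ae_of_all _ fun y => ?_)
  have hpos : 0 < 1 + ‖y‖ := by positivity
  rw [Real.norm_of_nonneg (Real.exp_pos _).le, Real.rpow_neg hpos.le, Real.rpow_natCast]
  have h2 := Real.pow_div_factorial_le_exp (c * (1 + ‖y‖)) (by positivity) (n + 1)
  have h3 : Real.exp (-(c * ‖y‖)) = Real.exp c * (Real.exp (c * (1 + ‖y‖)))⁻¹ := by
    rw [← Real.exp_neg, ← Real.exp_add]; congr 1; ring
  rw [h3, mul_div_assoc, mul_assoc]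
  refine mul_le_mul_of_nonneg_left ?_ (Real.exp_pos _).le
  refine (inv_anti₀ (by positivity) h2).trans_eq ?_
  rw [mul_pow]
  field_simp

theorem IsOpenCone.integrableOn_exp_neg_inner (hV : IsOpenCone V)
    {x : EuclideanSpace ℝ (Fin n)} (hx : x ∈ V) :
    IntegrableOn (fun y => Real.exp (-inner ℝ x y)) (dualOpenCone V) := by
  obtain ⟨c, hc, h⟩ := hV.exists_mul_norm_le_inner_dual hx
  refine (integrable_exp_neg_mul_norm hc).integrableOn.mono' (by fun_prop)
    ((ae_restrict_iff' hV.isOpen_dualOpenCone.measurableSet).2 (ae_of_all _ fun y hy => ?_))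
  rw [Real.norm_of_nonneg (Real.exp_pos _).le]
  exact Real.exp_le_exp.2 (neg_le_neg (h y hy))

theorem IsOpenCone.koszulChar_ne_top (hV : IsOpenCone V)
    {x : EuclideanSpace ℝ (Fin n)} (hx : x ∈ V) : koszulChar (dualOpenCone V) x ≠ ∞ :=
  (hV.integrableOn_exp_neg_inner hx).lintegral_lt_top.ne

theorem IsOpenCone.koszulChar_ne_zero (hV : IsOpenCone V) (hne : (dualOpenCone V).Nonempty)
    (x : EuclideanSpace ℝ (Fin n)) : koszulChar (dualOpenCone V) x ≠ 0 := by
  refine ((setLIntegral_pos_iff (by fun_prop)).2 ?_).ne'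
  have : Function.support (fun y : EuclideanSpace ℝ (Fin n) =>
      ENNReal.ofReal (Real.exp (-inner ℝ x y))) = Set.univ := by
    ext y; simp [Real.exp_pos]
  rw [this, Set.univ_inter]
  exact hV.isOpen_dualOpenCone.measure_pos volume hne

/-- Hahn–Banach separates `x` from `V`; stability of `V` under dilations forces the separating level
to be `0`. -/
theorem IsOpenCone.exists_supporting_functional (hV : IsOpenCone V)
    {x : EuclideanSpace ℝ (Fin n)} (hx : x ∈ closure V) (hxV : x ∉ V) :
    ∃ u : EuclideanSpace ℝ (Fin n), (∀ y ∈ V, 0 < inner ℝ u y) ∧ inner ℝ u x = 0 := by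
  obtain ⟨f, hf⟩ := geometric_hahn_banach_point_open hV.convex hV.isOpen hxV
  obtain ⟨u, rfl⟩ := (InnerProductSpace.toDual ℝ (EuclideanSpace ℝ (Fin n))).surjective f
  simp only [InnerProductSpace.toDual_apply_apply] at hf
  have hnn : ∀ y ∈ V, 0 ≤ inner ℝ u y := by
    intro y hy
    by_contra! hneg
    -- This dilation sends the value at `y` to `-(|u·x| + 1)`, below `u·x`.
    set r := (|inner ℝ u x| + 1) / (-inner ℝ u y) with hr
    have hrpos : 0 < r := div_pos (by positivity) (by linarith)
    have h1 := hf _ (hV.smul_mem y hy r hrpos)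
    have h2 : r * inner ℝ u y = -(|inner ℝ u x| + 1) := by
      rw [hr, div_mul_eq_mul_div, div_eq_iff (by linarith)]; ring
    rw [inner_smul_right, h2] at h1
    linarith [neg_abs_le (inner ℝ u x)]
  have hxle : inner ℝ u x ≤ 0 := by
    by_contra! hpos
    obtain ⟨y, hy⟩ := hV.nonempty
    have h0 : 0 ≤ inner ℝ u y := hnn y hy
    have hr : 0 < inner ℝ u x / (inner ℝ u y + 1) := by positivity
    have h1 := hf _ (hV.smul_mem y hy _ hr)
    rw [inner_smul_right, div_mul_eq_mul_div, lt_div_iff₀ (by positivity)] at h1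
    nlinarith
  have hxge : 0 ≤ inner ℝ u x :=
    (isClosed_le continuous_const (by fun_prop : Continuous fun y => (inner ℝ u y : ℝ))
      ).closure_subset_iff.2 hnn hx
  have hx0 := le_antisymm hxle hxge
  exact ⟨u, fun y hy => hx0 ▸ hf y hy, hx0⟩

/-- The characteristic function is infinite on the boundary of the cone: the weight
`exp (-x · y)` is invariant under translation by a boundary vector of the dual cone. -/
theorem IsOpenCone.koszulChar_eq_top (hV : IsOpenCone V) (hne : (dualOpenCone V).Nonempty)
    {x : EuclideanSpace ℝ (Fin n)} (hx : x ∈ closure V) (hxV : x ∉ V) :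
    koszulChar (dualOpenCone V) x = ∞ := by
  obtain ⟨u, hu, hux⟩ := hV.exists_supporting_functional hx hxV
  by_contra hfin
  set D := dualOpenCone V with hD
  have hDo : IsOpen D := hV.isOpen_dualOpenCone
  set ν : Measure (EuclideanSpace ℝ (Fin n)) :=
    volume.withDensity fun y => ENNReal.ofReal (Real.exp (-inner ℝ x y)) with hν
  have hνD : ∀ S, MeasurableSet S → ν S =
      ∫⁻ y in S, ENNReal.ofReal (Real.exp (-inner ℝ x y)) := fun S hS => withDensity_apply _ hS
  have hunn : ∀ y ∈ closure V, 0 ≤ inner ℝ u y := fun y hy =>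
    (isClosed_le continuous_const (by fun_prop : Continuous fun y => (inner ℝ u y : ℝ))
      ).closure_subset_iff.2 (fun y hy => (hu y hy).le) hy
  -- Translates of `D` by `N u`. They lie in `D` because `u ≥ 0` on `closure V`, and have the same
  -- `ν`-measure because `u·x = 0`. If that is finite, each `D \ T N` is null; yet these sets cover
  -- `D`, as `(y - N u)·z < 0` for large `N`.
  let T : ℕ → Set (EuclideanSpace ℝ (Fin n)) := fun N => (fun y => y - (N : ℝ) • u) ⁻¹' D
  have hTm : ∀ N, MeasurableSet (T N) := fun N =>
    (hDo.preimage (by fun_prop)).measurableSet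
  have hTD : ∀ N, T N ⊆ D := by
    intro N y hy z hz hz0
    have h1 := hy z hz hz0
    rw [inner_sub_left, inner_smul_left] at h1
    have h2 := mul_nonneg (Nat.cast_nonneg (α := ℝ) N) (hunn z hz)
    simp only [conj_trivial] at h1
    linarith
  have hνT : ∀ N, ν (T N) = ν D := by
    intro N
    rw [hνD _ (hTm N), hνD _ hDo.measurableSet, ← lintegral_indicator (hTm N),
      ← lintegral_indicator hDo.measurableSet,
      ← lintegral_sub_right_eq_self (D.indicator _) ((N : ℝ) • u)]
    refine lintegral_congr fun y => ?_
    by_cases hy : y ∈ T N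
    · rw [Set.indicator_of_mem hy, Set.indicator_of_mem (show y - (N : ℝ) • u ∈ D from hy),
        inner_sub_right, inner_smul_right, real_inner_comm u x, hux]
      simp
    · rw [Set.indicator_of_notMem hy,
        Set.indicator_of_notMem (show y - (N : ℝ) • u ∉ D from hy)]
  have hνfin : ν D ≠ ∞ := by rw [hνD _ hDo.measurableSet]; exact hfin
  have hdiff : ∀ N, ν (D \ T N) = 0 := by
    intro N
    rw [measure_sdiff (hTD N) (hTm N).nullMeasurableSet (by rw [hνT]; exact hνfin), hνT,
      tsub_self]
  obtain ⟨z, hz⟩ := hV.nonempty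
  have hcover : D ⊆ ⋃ N, D \ T N := by
    intro y hy
    have huz := hu z hz
    obtain ⟨N, hN⟩ := exists_nat_gt (inner ℝ y z / inner ℝ u z)
    rw [div_lt_iff₀ huz] at hN
    refine Set.mem_iUnion.2 ⟨N, hy, fun hT => ?_⟩
    have h1 := inner_nonneg_of_mem_dualOpenCone hT (subset_closure hz)
    rw [inner_sub_left, inner_smul_left] at h1
    simp only [conj_trivial] at h1
    linarith
  have hzero : ν D = 0 := measure_mono_null hcover (measure_iUnion_null hdiff)
  rw [hνD _ hDo.measurableSet] at hzero
  exact hV.koszulChar_ne_zero hne x hzero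

/-- For `ξ ∈ V*` the function `x ↦ exp (x · ξ) ∫_{V*} exp (-x · y) dy` has a minimiser on `V`. -/
theorem IsOpenCone.exists_isMinOn_exp_mul_koszulChar (hV : IsOpenCone V)
    {ξ : EuclideanSpace ℝ (Fin n)} (hξ : ξ ∈ dualOpenCone V) :
    ∃ x ∈ V, IsMinOn (fun x => ENNReal.ofReal (Real.exp (inner ℝ x ξ)) *
      koszulChar (dualOpenCone V) x) V x := by
  have hne : (dualOpenCone V).Nonempty := ⟨ξ, hξ⟩
  set F : EuclideanSpace ℝ (Fin n) → ℝ≥0∞ := fun x =>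
    ENNReal.ofReal (Real.exp (inner ℝ x ξ)) * koszulChar (dualOpenCone V) x with hF
  have hlsc : LowerSemicontinuous F := by
    have h : F = fun x => ∫⁻ y in dualOpenCone V,
        ENNReal.ofReal (Real.exp (inner ℝ x ξ - inner ℝ x y)) := by
      ext x
      simp only [hF, koszulChar]
      rw [← lintegral_const_mul' _ _ ENNReal.ofReal_ne_top]
      refine lintegral_congr fun y => ?_
      rw [← ENNReal.ofReal_mul (Real.exp_pos _).le, ← Real.exp_add, sub_eq_add_neg]
    rw [h]
    exact lowerSemicontinuous_lintegral_of_continuous (fun x => by fun_prop)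
      fun y => ENNReal.continuous_ofReal.comp (by fun_prop)
  have hfin : ∀ x ∈ V, F x ≠ ∞ := fun x hx =>
    ENNReal.mul_ne_top ENNReal.ofReal_ne_top (hV.koszulChar_ne_top hx)
  have htop : ∀ x ∈ closure V, x ∉ V → F x = ∞ := fun x hx hxV => by
    simp only [hF, hV.koszulChar_eq_top hne hx hxV]
    exact ENNReal.mul_top (by simp [Real.exp_pos])
  obtain ⟨c, hc, hcoer⟩ := hV.exists_mul_norm_le_inner_closure hξ
  -- On `B` the factor `exp(-x·y)` costs at most half of the growth `exp(c‖x‖)`, so `F` still grows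
  -- like `exp(c‖x‖/2)`.
  set B := dualOpenCone V ∩ Metric.ball 0 (c / 2) with hB
  have hBo : IsOpen B := hV.isOpen_dualOpenCone.inter Metric.isOpen_ball
  have hBne : B.Nonempty := by
    refine ⟨(c / (4 * (‖ξ‖ + 1))) • ξ, smul_mem_dualOpenCone hξ (by positivity), ?_⟩
    rw [mem_ball_zero_iff, norm_smul, Real.norm_of_nonneg (by positivity), div_mul_eq_mul_div,
      div_lt_div_iff₀ (by positivity) (by norm_num)]
    nlinarith [norm_nonneg ξ]
  have hBpos : volume B ≠ 0 := (hBo.measure_pos volume hBne).ne'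
  have hBfin : volume B ≠ ∞ :=
    ((measure_mono Set.inter_subset_right).trans_lt measure_ball_lt_top).ne
  have hlow : ∀ x ∈ closure V,
      ENNReal.ofReal (Real.exp (c / 2 * ‖x‖)) * volume B ≤ F x := by
    intro x hx
    have h1 : ENNReal.ofReal (Real.exp (-(c / 2 * ‖x‖))) * volume B ≤
        koszulChar (dualOpenCone V) x := by
      rw [← setLIntegral_const]
      refine le_trans (setLIntegral_mono' hBo.measurableSet fun y hy => ?_)
        (lintegral_mono_set Set.inter_subset_left)
      refine ENNReal.ofReal_le_ofReal (Real.exp_le_exp.2 (neg_le_neg ?_))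
      refine (real_inner_le_norm x y).trans ?_
      rw [mul_comm]
      exact mul_le_mul_of_nonneg_right (mem_ball_zero_iff.1 hy.2).le (norm_nonneg x)
    calc ENNReal.ofReal (Real.exp (c / 2 * ‖x‖)) * volume B
        = ENNReal.ofReal (Real.exp (c * ‖x‖)) *
          (ENNReal.ofReal (Real.exp (-(c / 2 * ‖x‖))) * volume B) := by
          rw [← mul_assoc, ← ENNReal.ofReal_mul (Real.exp_pos _).le, ← Real.exp_add]
          congr 4; ring
      _ ≤ F x := by
          refine mul_le_mul' (ENNReal.ofReal_le_ofReal (Real.exp_le_exp.2 ?_)) h1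
          rw [real_inner_comm]; exact hcoer x hx
  obtain ⟨x₀, hx₀⟩ := hV.nonempty
  set M := (F x₀ / volume B).toReal with hM
  -- For `‖x‖ > R`, `exp(c‖x‖/2) ≥ 1 + c‖x‖/2 > M`, so the lower bound exceeds `F x₀`; the search
  -- reduces to a compact set.
  set R := max ‖x₀‖ (2 / c * M) with hR
  have hfar : ∀ x ∈ closure V, R < ‖x‖ → F x₀ ≤ F x := by
    intro x hx hxR
    refine le_trans ?_ (hlow x hx)
    have hq : F x₀ / volume B ≠ ∞ := ENNReal.div_ne_top (hfin x₀ hx₀) hBpos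
    rw [← ENNReal.div_le_iff hBpos hBfin, ← ENNReal.ofReal_toReal hq]
    refine ENNReal.ofReal_le_ofReal ?_
    have h2 : 2 / c * M < ‖x‖ := (le_max_right _ _).trans_lt hxR
    have h3 : M < c / 2 * ‖x‖ := by
      rw [div_mul_eq_mul_div, div_lt_iff₀ hc] at h2; linarith
    linarith [Real.add_one_le_exp (c / 2 * ‖x‖)]
  have hK : IsCompact (closure V ∩ Metric.closedBall 0 R) :=
    (isCompact_closedBall _ _).inter_left isClosed_closure
  have hx₀K : x₀ ∈ closure V ∩ Metric.closedBall 0 R :=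
    ⟨subset_closure hx₀, mem_closedBall_zero_iff.2 (le_max_left _ _)⟩
  obtain ⟨x₁, hx₁, hmin⟩ :=
    LowerSemicontinuousOn.exists_isMinOn ⟨x₀, hx₀K⟩ hK (hlsc.lowerSemicontinuousOn _)
  have h10 : F x₁ ≤ F x₀ := hmin hx₀K
  refine ⟨x₁, ?_, fun x hx => ?_⟩
  -- A boundary point has `F = ∞`, hence cannot beat `x₀`.
  · by_contra hnot
    rw [htop x₁ hx₁.1 hnot, top_le_iff] at h10
    exact hfin x₀ hx₀ h10
  · change F x₁ ≤ F x
    by_cases hxR : ‖x‖ ≤ R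
    · exact hmin ⟨subset_closure hx, mem_closedBall_zero_iff.2 hxR⟩
    · exact h10.trans (hfar x (subset_closure hx) (not_le.1 hxR))

/-- `ξ` is determined by any minimiser of `x ↦ exp (x · ξ) ∫_{V*} exp (-x · y) dy` on `V`. -/
theorem IsOpenCone.eq_of_isMinOn_exp_mul_koszulChar (hV : IsOpenCone V)
    {ξ η x : EuclideanSpace ℝ (Fin n)} (hne : (dualOpenCone V).Nonempty) (hx : x ∈ V)
    (hξ : IsMinOn (fun x => ENNReal.ofReal (Real.exp (inner ℝ x ξ)) *
      koszulChar (dualOpenCone V) x) V x)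
    (hη : IsMinOn (fun x => ENNReal.ofReal (Real.exp (inner ℝ x η)) *
      koszulChar (dualOpenCone V) x) V x) : ξ = η := by
  set φ : EuclideanSpace ℝ (Fin n) → ℝ :=
    fun x => (koszulChar (dualOpenCone V) x).toReal with hφ
  have hφpos : 0 < φ x :=
    ENNReal.toReal_pos (hV.koszulChar_ne_zero hne x) (hV.koszulChar_ne_top hx)
  have hmin : ∀ ζ : EuclideanSpace ℝ (Fin n),
      IsMinOn (fun x => ENNReal.ofReal (Real.exp (inner ℝ x ζ)) *
        koszulChar (dualOpenCone V) x) V x →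
      IsMinOn (fun x => Real.exp (inner ℝ x ζ) * φ x) V x := by
    intro ζ h y hy
    have := ENNReal.toReal_mono (ENNReal.mul_ne_top ENNReal.ofReal_ne_top
      (hV.koszulChar_ne_top hy)) (h hy)
    simpa [ENNReal.toReal_mul, (Real.exp_pos _).le] using this
  refine ext_inner_left ℝ fun v => ?_
  have hline : ∀ᶠ t : ℝ in nhds 0, x + t • v ∈ V := by
    have hcont : Continuous fun t : ℝ => x + t • v := by fun_prop
    exact hcont.continuousAt.eventually_mem (by simpa using hV.isOpen.mem_nhds hx)
  -- Under this tilted measure, `t ↦ φ(x + t v)` is the moment generating function of `X = -v·y`,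
  -- which supplies differentiability at `0`.
  set μ : Measure (EuclideanSpace ℝ (Fin n)) := (volume.restrict (dualOpenCone V)).withDensity
    fun y => ENNReal.ofReal (Real.exp (-inner ℝ x y)) with hμ
  set X : EuclideanSpace ℝ (Fin n) → ℝ := fun y => -inner ℝ v y with hX
  have hexp : ∀ (t : ℝ) (y : EuclideanSpace ℝ (Fin n)),
      Real.exp (-inner ℝ x y) * Real.exp (t * X y) = Real.exp (-inner ℝ (x + t • v) y) := by
    intro t y
    rw [← Real.exp_add, inner_add_left, inner_smul_left]
    congr 1
    simp only [hX, conj_trivial]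
    ring
  have hmem : ∀ t : ℝ, x + t • v ∈ V → t ∈ ProbabilityTheory.integrableExpSet X μ := by
    intro t ht
    rw [ProbabilityTheory.integrableExpSet, Set.mem_ofPred_eq, hμ,
      integrable_withDensity_iff (by fun_prop) (ae_of_all _ fun _ => ENNReal.ofReal_lt_top)]
    refine (hV.integrableOn_exp_neg_inner ht).congr (ae_of_all _ fun y => ?_)
    simp only [ENNReal.toReal_ofReal (Real.exp_pos _).le]
    rw [← hexp, mul_comm]
  have hmgf : ∀ t : ℝ, ProbabilityTheory.mgf X μ t = φ (x + t • v) := by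
    intro t
    rw [ProbabilityTheory.mgf, integral_eq_lintegral_of_nonneg_ae
      (ae_of_all _ fun y => (Real.exp_pos _).le) (by fun_prop), hμ,
      lintegral_withDensity_eq_lintegral_mul _ (by fun_prop) (by fun_prop), hφ]
    simp only [koszulChar, Pi.mul_apply]
    congr 1
    refine lintegral_congr fun y => ?_
    rw [← ENNReal.ofReal_mul (Real.exp_pos _).le, hexp]
  have hint : (0 : ℝ) ∈ interior (ProbabilityTheory.integrableExpSet X μ) :=
    mem_interior_iff_mem_nhds.2 (hline.mono hmem)
  have hder := ProbabilityTheory.hasDerivAt_mgf hint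
  set d := ∫ ω, X ω * Real.exp (0 * X ω) ∂μ with hd
  -- Critical-point equation in direction `v`. As `d` does not involve `ζ`, it fixes `v·ζ`.
  have hcrit : ∀ ζ : EuclideanSpace ℝ (Fin n),
      IsMinOn (fun x => Real.exp (inner ℝ x ζ) * φ x) V x → inner ℝ v ζ * φ x + d = 0 := by
    intro ζ h
    have h1 : HasDerivAt (fun t : ℝ => Real.exp (t * inner ℝ v ζ))
        (inner ℝ v ζ) 0 := by
      simpa using ((hasDerivAt_id (0 : ℝ)).mul_const (inner ℝ v ζ)).exp
    have h2 := h1.mul hder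
    have hloc : IsLocalMin ((fun t : ℝ => Real.exp (t * inner ℝ v ζ)) *
        ProbabilityTheory.mgf X μ) 0 := by
      filter_upwards [hline] with t ht
      have h3 := h ht
      simp only [Set.mem_ofPred_eq] at h3
      rw [inner_add_left, inner_smul_left, Real.exp_add, mul_assoc] at h3
      have h4 := le_of_mul_le_mul_left h3 (Real.exp_pos _)
      simpa [hmgf] using h4
    have h5 := hloc.hasDerivAt_eq_zero h2
    simpa [hmgf] using h5
  have e1 := hcrit ξ (hmin ξ hξ)
  have e2 := hcrit η (hmin η hη)
  exact mul_right_cancel₀ hφpos.ne' (by linarith)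

/-- The dual of a homogeneous cone is homogeneous under the contragredient action of `G(V)`. -/
theorem IsHomogeneousCone.transitive_dual (hV : IsHomogeneousCone V)
    {ξ η : EuclideanSpace ℝ (Fin n)} (hξ : ξ ∈ dualOpenCone V) (hη : η ∈ dualOpenCone V) :
    ∃ A ∈ coneAut V, η = matAct (Aᵀ)⁻¹ ξ := by
  have hC := hV.toIsOpenCone
  obtain ⟨x, hx, hxmin⟩ := hC.exists_isMinOn_exp_mul_koszulChar hξ
  obtain ⟨y, hy, hymin⟩ := hC.exists_isMinOn_exp_mul_koszulChar hη
  obtain ⟨A, hA, rfl⟩ := hV.transitive x hx y hy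
  have hdet := det_ne_zero_of_image_matAct hV.isOpen hV.nonempty hA
  -- It remains to see that `A x`, a minimiser for `η`, is also one for `(Aᵀ)⁻¹ξ`: the pairing is
  -- invariant and `φ` changes by a constant factor.
  refine ⟨A, hA, hC.eq_of_isMinOn_exp_mul_koszulChar ⟨ξ, hξ⟩ hy hymin fun z hz => ?_⟩
  obtain ⟨w, hw, rfl⟩ : z ∈ matAct A '' V := by rwa [show matAct A '' V = V from hA]
  have hm := hC.isOpen_dualOpenCone.measurableSet
  have hi := hC.image_dualOpenCone hA
  have hin : ∀ w, (inner ℝ (matAct A w) (matAct (Aᵀ)⁻¹ ξ) : ℝ) = inner ℝ w ξ := fun w => by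
    rw [real_inner_comm, inner_matAct_transpose_inv hdet, real_inner_comm]
  have h := hxmin hw
  simp only [Set.mem_ofPred_eq] at h ⊢
  rw [koszulChar_matAct hm hdet hi, koszulChar_matAct hm hdet hi, hin, hin, mul_left_comm,
    mul_left_comm (ENNReal.ofReal (Real.exp (inner ℝ w ξ)))]
  exact mul_le_mul_right h _

end Laplace

/-! ### Invariance of the weighted integral and the final estimate. -/

theorem IsHomogeneousCone.coneDelta_rpow_mul_lintegral_eq {n : ℕ}
    {V : Set (EuclideanSpace ℝ (Fin n))} (hV : IsHomogeneousCone V) {β δ : ℝ}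
    {k : EuclideanSpace ℝ (Fin n) → EuclideanSpace ℝ (Fin n) → ℝ≥0}
    (hk_hom : IsDualHomogeneousKernel V β k)
    {ξ η : EuclideanSpace ℝ (Fin n)} (hξ : ξ ∈ dualOpenCone V) (hη : η ∈ dualOpenCone V) :
    coneDelta (dualOpenCone V) η ^ (1 + δ + β) *
        ∫⁻ y in V, (k η y : ℝ≥0∞) * coneDelta V y ^ δ =
      coneDelta (dualOpenCone V) ξ ^ (1 + δ + β) *
        ∫⁻ y in V, (k ξ y : ℝ≥0∞) * coneDelta V y ^ δ := by
  have hC := hV.toIsOpenCone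
  obtain ⟨A, hA, rfl⟩ := hV.transitive_dual hξ hη
  have hdet := det_ne_zero_of_image_matAct hV.isOpen hV.nonempty hA
  have hpos : 0 < |A.det| := abs_pos.2 hdet
  set a : ℝ≥0∞ := ENNReal.ofReal |A.det| with ha
  have ha0 : a ≠ 0 := by simpa [ha] using hdet
  have hat : a ≠ ∞ := ENNReal.ofReal_ne_top
  obtain ⟨x, hx⟩ := hV.nonempty
  obtain ⟨c, hc, hle⟩ := hC.exists_mul_norm_le_inner_dual hx
  obtain ⟨c', hc', hle'⟩ := hC.exists_mul_norm_le_inner_closure hξ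
  have hΔt : ∀ y, coneDelta V y ≠ ∞ :=
    coneDelta_ne_top hc' fun z hz => hle' z (subset_closure hz)
  have hΔ : coneDelta (dualOpenCone V) (matAct (Aᵀ)⁻¹ ξ) =
      a⁻¹ * coneDelta (dualOpenCone V) ξ := by
    rw [coneDelta_matAct (det_transpose_inv_ne_zero hdet) (hC.image_dualOpenCone hA),
      Matrix.det_nonsing_inv, Matrix.det_transpose, Ring.inverse_eq_inv', abs_inv,
      ENNReal.ofReal_inv_of_pos hpos]
  -- In the exponent, `1` is the Jacobian, `δ` comes from `Δ_V(Ay)` and `β` from the kernel.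
  have hint : ∫⁻ y in V, (k (matAct (Aᵀ)⁻¹ ξ) y : ℝ≥0∞) * coneDelta V y ^ δ =
      a ^ (1 + δ + β) * ∫⁻ y in V, (k ξ y : ℝ≥0∞) * coneDelta V y ^ δ := by
    rw [setLIntegral_comp_matAct hdet hV.isOpen.measurableSet hA,
      ← lintegral_const_mul' _ _ hat,
      ← lintegral_const_mul' _ _ (ENNReal.rpow_ne_top_of_ne_zero ha0 hat)]
    refine setLIntegral_congr_fun hV.isOpen.measurableSet fun y hy => ?_
    have hk : (k (matAct (Aᵀ)⁻¹ ξ) (matAct A y) : ℝ≥0∞) = a ^ β * (k ξ y : ℝ≥0∞) := by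
      rw [← ENNReal.ofReal_coe_nnreal, hk_hom A hA ξ hξ y hy,
        ENNReal.ofReal_mul (by positivity), ENNReal.ofReal_coe_nnreal,
        ENNReal.ofReal_rpow_of_pos hpos]
    simp only [hk, coneDelta_matAct hdet (show matAct A '' V = V from hA)]
    rw [ENNReal.mul_rpow_of_ne_top hat (hΔt y),
      ENNReal.rpow_add _ _ ha0 hat, ENNReal.rpow_add _ _ ha0 hat, ENNReal.rpow_one]
    ring
  rw [hint, hΔ, ENNReal.mul_rpow_of_ne_top (ENNReal.inv_ne_top.2 ha0)
    (coneDelta_ne_top hc hle ξ), ENNReal.inv_rpow, mul_mul_mul_comm,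
    ENNReal.inv_mul_cancel (by simp [ENNReal.rpow_eq_zero_iff, ha0, hat])
      (ENNReal.rpow_ne_top_of_ne_zero ha0 hat), one_mul]

theorem theorem3p12 {n : ℕ} (V : Set (EuclideanSpace ℝ (Fin n))) (hV : IsHomogeneousCone V)
    (β δ : ℝ)
    (k : EuclideanSpace ℝ (Fin n) → EuclideanSpace ℝ (Fin n) → ℝ≥0)
    (hk_meas : ∀ x ∈ dualOpenCone V, AEMeasurable (k x) (volume.restrict V))
    (hk_hom : IsDualHomogeneousKernel V β k)
    (hk_fin : ∀ x ∈ dualOpenCone V, ∫⁻ y in V, (k x y : ℝ≥0∞) * coneDelta V y ^ δ < ∞) :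
    ∃ c : ℝ≥0, ∀ f : EuclideanSpace ℝ (Fin n) → ℝ≥0,
      AEMeasurable f (volume.restrict V) →
      essSup (fun x => coneDelta (dualOpenCone V) x ^ (1 + δ + β) * coneOperator V k f x)
          (volume.restrict (dualOpenCone V)) ≤
        (c : ℝ≥0∞) *
          essSup (fun y => (f y : ℝ≥0∞) * coneDelta V y ^ (-δ)) (volume.restrict V) := by
  have hC := hV.toIsOpenCone
  rcases (dualOpenCone V).eq_empty_or_nonempty with hemp | ⟨ξ, hξ⟩
  · exact ⟨0, fun f _ => by simp [hemp]⟩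
  obtain ⟨x₀, hx₀⟩ := hV.nonempty
  obtain ⟨c', hc', hle'⟩ := hC.exists_mul_norm_le_inner_dual hx₀
  obtain ⟨c, hc, hle⟩ := hC.exists_mul_norm_le_inner_closure hξ
  have hΔ0 : ∀ y ∈ V, coneDelta V y ≠ 0 := fun y hy =>
    coneDelta_ne_zero hV.isOpen hV.smul_mem hy
  have hΔt : ∀ y, coneDelta V y ≠ ∞ := fun y =>
    coneDelta_ne_top hc (fun z hz => hle z (subset_closure hz)) y
  set C : ℝ≥0∞ := coneDelta (dualOpenCone V) ξ ^ (1 + δ + β) *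
    ∫⁻ y in V, (k ξ y : ℝ≥0∞) * coneDelta V y ^ δ with hCdef
  have hCt : C ≠ ∞ := ENNReal.mul_ne_top
    (ENNReal.rpow_ne_top_of_ne_zero
      (coneDelta_ne_zero hC.isOpen_dualOpenCone (fun x hx r hr => smul_mem_dualOpenCone hx hr) hξ)
      (coneDelta_ne_top hc' hle' ξ)) (hk_fin ξ hξ).ne
  -- The `+ 1` keeps the constant non-zero, so that the bound is trivial when `M = ∞`, even if `C =
  -- 0`.
  refine ⟨C.toNNReal + 1, fun f _ => ?_⟩
  set M := essSup (fun y => (f y : ℝ≥0∞) * coneDelta V y ^ (-δ)) (volume.restrict V) with hM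
  rw [ENNReal.coe_add, ENNReal.coe_toNNReal hCt, ENNReal.coe_one]
  rcases eq_or_ne M ∞ with hMt | hMt
  · rw [hMt, ENNReal.mul_top (by simp)]
    exact le_top
  -- Undoing the weight is legitimate because `0 < Δ_V < ∞` on `V`.
  have hf : ∀ᵐ y ∂volume.restrict V, (f y : ℝ≥0∞) ≤ M * coneDelta V y ^ δ := by
    filter_upwards [ENNReal.ae_le_essSup (μ := volume.restrict V)
      (fun y => (f y : ℝ≥0∞) * coneDelta V y ^ (-δ)),
      ae_restrict_mem hV.isOpen.measurableSet] with y hy hyV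
    calc (f y : ℝ≥0∞) = f y * coneDelta V y ^ (-δ) * coneDelta V y ^ δ := by
          rw [mul_assoc, ← ENNReal.rpow_add _ _ (hΔ0 y hyV) (hΔt y)]; simp
      _ ≤ M * coneDelta V y ^ δ := by gcongr
  refine essSup_le_of_ae_le _ ?_
  filter_upwards [ae_restrict_mem hC.isOpen_dualOpenCone.measurableSet] with η hη
  calc coneDelta (dualOpenCone V) η ^ (1 + δ + β) * coneOperator V k f η
      ≤ coneDelta (dualOpenCone V) η ^ (1 + δ + β) *
          ∫⁻ y in V, M * ((k η y : ℝ≥0∞) * coneDelta V y ^ δ) := by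
        gcongr
        refine lintegral_mono_ae (hf.mono fun y hy => ?_)
        rw [mul_left_comm]
        gcongr
    _ = C * M := by
        rw [lintegral_const_mul' _ _ hMt, mul_left_comm,
          hV.coneDelta_rpow_mul_lintegral_eq hk_hom hξ hη, mul_comm]
    _ ≤ (C + 1) * M := by gcongr; exact le_self_add
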